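/- Let $(F,g_F)$ be a smooth Riemannian manifold without boundary, $\dim F=s$, let $f:F\to(0,\infty)$ be smooth, and let $I=(t_1,t_2)$ with $-\infty\le t_1<t_2\le\infty$. Let $M=I_f\times F$ be the standard static space-time, i.e. the manifold $I\times F$ with the Lorentzian metric $g=-f^2\,dt^2\oplus g_F$. Denote by $\mathrm{Ric}_{g_F},\tau_{g_F},\mathrm H^f_{g_F},\Delta_{g_F}f=\operatorname{tr}_{g_F}\mathrm H^f_{g_F}$ the Ricci tensor, the scalar curvature, the Hessian of $f$ and the Laplacian of $f$ on $(F,g_F)$, and put $$Q^f_{g_F}=\Delta_{g_F}f\,g_F-\mathrm H^f_{g_F},\qquad \mathscr L^*_{g_F}f=-f\,\mathrm{Ric}_{g_F}-\Delta_{g_F}f\,g_F+\mathrm H^f_{g_F}.$$ Let $T$ be the energy-momentum tensor of $(M,g)$ determined by the Einstein equation $\mathrm{Ric}-\tfrac12\tau g=8\pi T$, where $\mathrm{Ric}$ and $\tau$ are the Ricci tensor and the scalar curvature of $g$. A tangent vector $w$ is causal if $w\ne0$ and $g(w,w)\le0$; two causal vectors $w_1,w_2$ at the same point are in the same time-cone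 if there is a time-like vector $z$ at that point with $g(z,w_1)<0$ and $g(z,w_2)<0$. 1. If $\mathscr L^*_{g_F}f\equiv0$, then $8\pi T=-\tfrac12\tau_{g_F}\,g$. Moreover, in this case, $T(w_1,w_2)\ge0$ for all causal $w_1,w_2\in TM$ in the same time-cone if and only if $\tau_{g_F}\ge0$ on $F$. 2. If $(F,g_F)$ is Ricci flat, then for all $(t,x)\in I\times F$, $u_1,u_2\in T_tI$ and $v_1,v_2\in T_xF$, $$8\pi T(u_1+v_1,u_2+v_2)=\frac1{f(x)}\,Q^f_{g_F}(v_1,v_2).$$ Moreover, in this case, the following are equivalent: (a) $T(w_1,w_2)\ge0$ for all causal $w_1,w_2\in TM$ in the same time-cone; (b) $Q^f_{g_F}\equiv0$; (c) $\mathscr L^*_{g_F}f\equiv0$. -/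

import Mathlib

set_option maxSynthPendingDepth 3

open Set Manifold ContDiff TopologicalSpace

noncomputable section

namespace StaticSpacetime

/-! ### Tensor calculus in an open piece of a finite-dimensional vector space

Here `G : E → E →L[ℝ] E →L[ℝ] ℝ` is a (pseudo-Riemannian) metric written in coordinates. -/

section Coordinates

variable {E : Type*} [NormedAddCommGroup E] [NormedSpace ℝ E]

/-- Christoffel symbols of the first kind:
`(u, v, w) ↦ ½ (∂ᵤ G(v, w) + ∂ᵥ G(u, w) - ∂_w G(u, v))`. -/
def christoffelFirst (G : E → E →L[ℝ] E →L[ℝ] ℝ) (y : E) : E →L[ℝ] E →L[ℝ] E →L[ℝ] ℝ :=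
  let swap : (E →L[ℝ] E →L[ℝ] ℝ) →L[ℝ] (E →L[ℝ] E →L[ℝ] ℝ) :=
    (ContinuousLinearMap.flipₗᵢ ℝ E E ℝ).toContinuousLinearEquiv
  let D : E →L[ℝ] E →L[ℝ] E →L[ℝ] ℝ := fderiv ℝ G y
  let K : E →L[ℝ] E →L[ℝ] E →L[ℝ] ℝ := D + D.flip - swap.comp D.flip
  (1 / 2 : ℝ) • K

theorem christoffelFirst_apply (G : E → E →L[ℝ] E →L[ℝ] ℝ) (y u v w : E) :
    christoffelFirst G y u v w =
      1 / 2 * (fderiv ℝ G y u v w + fderiv ℝ G y v u w - fderiv ℝ G y w u v) := rfl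

/-- Christoffel symbols of the second kind, as the vector `Γ(u, v)` with
`G(Γ(u, v), w) = ½ (∂ᵤ G(v, w) + ∂ᵥ G(u, w) - ∂_w G(u, v))`; that is, the Levi-Civita derivative
of the constant field `v` in the direction `u`. -/
def christoffel (G : E → E →L[ℝ] E →L[ℝ] ℝ) (y : E) : E →L[ℝ] E →L[ℝ] E :=
  ContinuousLinearMap.compL ℝ E (E →L[ℝ] ℝ) E (G y).inverse ∘L christoffelFirst G y

theorem christoffel_apply (G : E → E →L[ℝ] E →L[ℝ] ℝ) (y u v : E) :
    christoffel G y u v = (G y).inverse (christoffelFirst G y u v) := rfl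

/-- For fixed `v`, `w`, the endomorphism `u ↦ R(u, v) w` of the curvature tensor. -/
def curvatureEnd (G : E → E →L[ℝ] E →L[ℝ] ℝ) (y v w : E) : E →L[ℝ] E :=
  ((fderiv ℝ (christoffel G) y).flip v).flip w - (fderiv ℝ (christoffel G) y v).flip w
    + (christoffel G y).flip (christoffel G y v w)
    - (christoffel G y v) ∘L (christoffel G y).flip w

/-- `R(u, v) w = (∂ᵤ Γ)(v, w) - (∂ᵥ Γ)(u, w) + Γ(u, Γ(v, w)) - Γ(v, Γ(u, w))`. -/
theorem curvatureEnd_apply (G : E → E →L[ℝ] E →L[ℝ] ℝ) (y u v w : E) :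
    curvatureEnd G y v w u =
      fderiv ℝ (christoffel G) y u v w - fderiv ℝ (christoffel G) y v u w
        + christoffel G y u (christoffel G y v w)
        - christoffel G y v (christoffel G y u w) := rfl

/-- The Ricci tensor `Ric(v, w) = tr (u ↦ R(u, v) w)` (positive on round spheres). -/
def coordRicci (G : E → E →L[ℝ] E →L[ℝ] ℝ) (y : E) : E →ₗ[ℝ] E →ₗ[ℝ] ℝ :=
  LinearMap.mk₂ ℝ (fun v w => LinearMap.trace ℝ E (curvatureEnd G y v w : E →ₗ[ℝ] E))
    (fun v v' w => by
      rw [← map_add]; congr 1; ext u; simp [curvatureEnd_apply]; abel)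
    (fun c v w => by
      rw [← map_smul]; congr 1; ext u; simp [curvatureEnd_apply, smul_add, smul_sub])
    (fun v w w' => by
      rw [← map_add]; congr 1; ext u; simp [curvatureEnd_apply]; abel)
    (fun c v w => by
      rw [← map_smul]; congr 1; ext u; simp [curvatureEnd_apply, smul_add, smul_sub])

/-- The Hessian `∇²h (v, w) = ∂ᵥ ∂_w h - dh (Γ(v, w))`. -/
def coordHessian (G : E → E →L[ℝ] E →L[ℝ] ℝ) (h : E → ℝ) (y : E) : E →ₗ[ℝ] E →ₗ[ℝ] ℝ :=
  LinearMap.mk₂ ℝ (fun v w => fderiv ℝ (fderiv ℝ h) y v w - fderiv ℝ h y (christoffel G y v w))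
    (fun v v' w => by simp; ring)
    (fun c v w => by simp; ring)
    (fun v w w' => by simp; ring)
    (fun c v w => by simp; ring)

/-- The metric trace `G^{ij} B_{ij}` of a bilinear form `B`, that is, the trace of the
endomorphism `A` with `G(A v, w) = B(v, w)`. -/
def metricTrace [FiniteDimensional ℝ E] (G : E →L[ℝ] E →L[ℝ] ℝ) (B : E →ₗ[ℝ] E →ₗ[ℝ] ℝ) : ℝ :=
  LinearMap.trace ℝ E
    ((G.inverse : (E →L[ℝ] ℝ) →ₗ[ℝ] E) ∘ₗ
      (LinearMap.toContinuousLinearMap : (E →ₗ[ℝ] ℝ) ≃ₗ[ℝ] (E →L[ℝ] ℝ)).toLinearMap ∘ₗ B)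

end Coordinates

/-! ### Tensor calculus on a manifold without boundary

All quantities at a point `x` are computed in the preferred chart at `x`; the value does not depend
on that choice, because these are tensors. -/

section Manifolds

variable {E : Type*} [NormedAddCommGroup E] [NormedSpace ℝ E]
  {H : Type*} [TopologicalSpace H] (I : ModelWithCorners ℝ E H) [I.Boundaryless]
  {N : Type*} [TopologicalSpace N] [ChartedSpace H N]

/-- A field of bilinear forms on the tangent spaces, such as a pseudo-Riemannian metric. -/
abbrev MetricField (N : Type*) [TopologicalSpace N] [ChartedSpace H N] : Type _ :=
  (x : N) → TangentSpace I x →L[ℝ] TangentSpace I x →L[ℝ] ℝ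

/-- The metric `g` written in the chart at `x`: its pullback under the inverse of the chart. -/
def coordMetric (g : MetricField I N) (x : N) (y : E) : E →L[ℝ] E →L[ℝ] ℝ :=
  let A : E →L[ℝ] E := mfderivWithin 𝓘(ℝ, E) I (extChartAt I x).symm (range I) y
  let B : E →L[ℝ] E →L[ℝ] ℝ := g ((extChartAt I x).symm y)
  B.bilinearComp A A

/-- The differential at `x` of the chart at `x`. -/
def chartDeriv (x : N) : TangentSpace I x →ₗ[ℝ] E :=
  let D : E →L[ℝ] E := mfderiv I 𝓘(ℝ, E) (extChartAt I x) x
  (D : E →ₗ[ℝ] E)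

/-- The Ricci tensor of the Levi-Civita connection of `g`. -/
def ricci (g : MetricField I N) (x : N) : TangentSpace I x →ₗ[ℝ] TangentSpace I x →ₗ[ℝ] ℝ :=
  (coordRicci (coordMetric I g x) (extChartAt I x x)).compl₁₂ (chartDeriv I x) (chartDeriv I x)

/-- The scalar curvature of `g`: the metric trace of the Ricci tensor. -/
def scalarCurvature [FiniteDimensional ℝ E] (g : MetricField I N) (x : N) : ℝ :=
  metricTrace (coordMetric I g x (extChartAt I x x))
    (coordRicci (coordMetric I g x) (extChartAt I x x))

/-- The Hessian tensor of the function `h` with respect to `g`. -/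
def hessian (g : MetricField I N) (h : N → ℝ) (x : N) :
    TangentSpace I x →ₗ[ℝ] TangentSpace I x →ₗ[ℝ] ℝ :=
  (coordHessian (coordMetric I g x) (h ∘ (extChartAt I x).symm) (extChartAt I x x)).compl₁₂
    (chartDeriv I x) (chartDeriv I x)

/-- The Laplace-Beltrami operator: the metric trace of the Hessian. -/
def laplacian [FiniteDimensional ℝ E] (g : MetricField I N) (h : N → ℝ) (x : N) : ℝ :=
  metricTrace (coordMetric I g x (extChartAt I x x))
    (coordHessian (coordMetric I g x) (h ∘ (extChartAt I x).symm) (extChartAt I x x))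

/-- The tensor `Q_g^h = (Δ_g h) g - Hess_g h`. -/
def tensorQ [FiniteDimensional ℝ E] (g : MetricField I N) (h : N → ℝ) (x : N)
    (v w : TangentSpace I x) : ℝ :=
  laplacian I g h x * g x v w - hessian I g h x v w

/-- The tensor `L_g^* h = - h Ric_g - (Δ_g h) g + Hess_g h`. -/
def tensorLstar [FiniteDimensional ℝ E] (g : MetricField I N) (h : N → ℝ) (x : N)
    (v w : TangentSpace I x) : ℝ :=
  -(h x * ricci I g x v w) - laplacian I g h x * g x v w + hessian I g h x v w

/-- The energy-momentum tensor given by the Einstein equation `Ric - ½ τ g = 8 π T`. -/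
def energyMomentum [FiniteDimensional ℝ E] (g : MetricField I N) (x : N)
    (v w : TangentSpace I x) : ℝ :=
  1 / (8 * Real.pi) * (ricci I g x v w - 1 / 2 * scalarCurvature I g x * g x v w)

/-- A causal tangent vector: non-zero, and time-like or null. -/
def IsCausal (g : MetricField I N) {x : N} (w : TangentSpace I x) : Prop :=
  w ≠ 0 ∧ g x w w ≤ 0

/-- The vectors `w₁`, `w₂` lie in the same (closed) time-cone, namely in that of some time-like
vector `z`. -/
def SameTimeCone (g : MetricField I N) {x : N} (w₁ w₂ : TangentSpace I x) : Prop :=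
  ∃ z : TangentSpace I x, g x z z < 0 ∧ g x z w₁ < 0 ∧ g x z w₂ < 0

/-- `T(w₁, w₂) ≥ 0` for all causal vectors `w₁`, `w₂` in the same time-cone. -/
def DominantCondition [FiniteDimensional ℝ E] (g : MetricField I N) : Prop :=
  ∀ (x : N) (w₁ w₂ : TangentSpace I x), IsCausal I g w₁ → IsCausal I g w₂ →
    SameTimeCone I g w₁ w₂ → 0 ≤ energyMomentum I g x w₁ w₂

end Manifolds

/-! ### Standard static space-times -/

section Static

/-- The open interval `(t₁, t₂)`, possibly unbounded, as an open subset of `ℝ`. -/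
def openInterval (t₁ t₂ : EReal) : Opens ℝ :=
  ⟨{t : ℝ | t₁ < (t : EReal) ∧ (t : EReal) < t₂},
    (isOpen_lt continuous_const continuous_coe_real_ereal).inter
      (isOpen_lt continuous_coe_real_ereal continuous_const)⟩

variable {s : ℕ} (t₁ t₂ : EReal) (F : Type*) [TopologicalSpace F]
  [ChartedSpace (EuclideanSpace ℝ (Fin s)) F]

/-- The model with corners of the product of an interval and an `s`-dimensional manifold. -/
abbrev staticModel (s : ℕ) : ModelWithCorners ℝ (ℝ × EuclideanSpace ℝ (Fin s))
    (ModelProd ℝ (EuclideanSpace ℝ (Fin s))) :=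
  𝓘(ℝ, ℝ).prod (𝓡 s)

variable {F}

/-- The differential `dt` of the time coordinate `(t, x) ↦ t`. -/
def timeForm (p : openInterval t₁ t₂ × F) : TangentSpace (staticModel s) p →L[ℝ] ℝ :=
  mfderiv (staticModel s) 𝓘(ℝ, ℝ) (fun q : openInterval t₁ t₂ × F => (q.1 : ℝ)) p

/-- The differential of the projection onto the fiber `F`. -/
def fiberProj (p : openInterval t₁ t₂ × F) :
    TangentSpace (staticModel s) p →L[ℝ] TangentSpace (𝓡 s) p.2 :=
  mfderiv (staticModel s) (𝓡 s) (Prod.snd : openInterval t₁ t₂ × F → F) p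

/-- The metric `-f² dt² ⊕ g_F` of the standard static space-time `(t₁, t₂) _f × F`. -/
def staticMetric (gF : MetricField (𝓡 s) F) (f : F → ℝ) :
    MetricField (staticModel s) (openInterval t₁ t₂ × F) := fun p =>
  let dt : ℝ × EuclideanSpace ℝ (Fin s) →L[ℝ] ℝ := timeForm t₁ t₂ p
  let P : ℝ × EuclideanSpace ℝ (Fin s) →L[ℝ] EuclideanSpace ℝ (Fin s) := fiberProj t₁ t₂ p
  let B : EuclideanSpace ℝ (Fin s) →L[ℝ] EuclideanSpace ℝ (Fin s) →L[ℝ] ℝ := gF p.2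
  B.bilinearComp P P - (f p.2) ^ 2 • (ContinuousLinearMap.mul ℝ ℝ).bilinearComp dt dt

theorem staticMetric_apply (gF : MetricField (𝓡 s) F) (f : F → ℝ)
    (p : openInterval t₁ t₂ × F) (w₁ w₂ : TangentSpace (staticModel s) p) :
    staticMetric t₁ t₂ gF f p w₁ w₂ =
      gF p.2 (fiberProj t₁ t₂ p w₁) (fiberProj t₁ t₂ p w₂) -
        (f p.2) ^ 2 * (timeForm t₁ t₂ p w₁ * timeForm t₁ t₂ p w₂) := rfl

/-- The tangent vector `u + v` at `(t, x)` with `u ∈ T_t I` and `v ∈ T_x F`: the sum of the images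
under the differentials of the two inclusions `I × {x}` and `{t} × F`. -/
def sumVector (t : openInterval t₁ t₂) (x : F) (u : TangentSpace 𝓘(ℝ, ℝ) t)
    (v : TangentSpace (𝓡 s) x) : TangentSpace (staticModel s) (t, x) :=
  mfderiv 𝓘(ℝ, ℝ) (staticModel s) (fun t' : openInterval t₁ t₂ => (t', x)) t u +
    mfderiv (𝓡 s) (staticModel s) (fun x' : F => (t, x')) x v

end Static

end StaticSpacetime

end

/-! In coordinates the metric is `-f² dt² + g_F` with coefficients independent of `t`, so its only
Christoffel symbols besides those of `g_F` are `Γ(∂ₜ, v) = (df(v) / f) ∂ₜ` and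
`Γ(∂ₜ, ∂ₜ) = f grad f`. Tracing the curvature over `∂ₜ` and over the fiber separately gives
`Ric = Ric_F - H^f / f + f Δf dt²` and `τ = τ_F - 2 Δf / f`, hence
`8 π T = -½ τ_F g - (1 / f) L*f` with `L*f` evaluated on the fiber components.

If `L*f = 0`, the sign of `T` on a time-cone is that of `τ_F`, because the Cauchy-Schwarz inequality
on the fiber makes `g(w₁, w₂) ≤ 0` for causal vectors in a common time-cone. If `Ric_F = 0`, then
`8 π T = Q / f` only sees the fiber components, and any two fiber vectors `v₁`, `v₂` become
time-like vectors of a common time-cone once a large multiple of `∂ₜ` is added to both. So the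
energy condition says `Q(v₁, v₂) ≥ 0` for all `v₁`, `v₂`, and replacing `v₂` by `-v₂` yields
`Q = 0`.
-/

noncomputable section

open scoped Topology

namespace StaticSpacetime

section LinearAlgebra

theorem trace_prod {R M N : Type*} [CommRing R] [AddCommGroup M] [Module R M] [Module.Free R M]
    [Module.Finite R M] [AddCommGroup N] [Module R N] [Module.Free R N] [Module.Finite R N]
    (T : M × N →ₗ[R] M × N) :
    LinearMap.trace R (M × N) T =
      LinearMap.trace R M (.fst R M N ∘ₗ T ∘ₗ .inl R M N) +
        LinearMap.trace R N (.snd R M N ∘ₗ T ∘ₗ .inr R M N) := by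
  have hT : T = (T ∘ₗ .inl R M N) ∘ₗ .fst R M N + (T ∘ₗ .inr R M N) ∘ₗ .snd R M N := by
    ext <;> simp [← Prod.zero_eq_mk]
  conv_lhs => rw [hT]
  rw [map_add, LinearMap.trace_comp_comm', LinearMap.trace_comp_comm' (T ∘ₗ .inr R M N)]

variable {E : Type*} [NormedAddCommGroup E] [NormedSpace ℝ E]

theorem isInvertible_of_pos [FiniteDimensional ℝ E] {g : E →L[ℝ] E →L[ℝ] ℝ}
    (hg : ∀ v, v ≠ 0 → 0 < g v v) : g.IsInvertible := by
  have hinj : Function.Injective (g : E →ₗ[ℝ] E →L[ℝ] ℝ) := by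
    rw [injective_iff_map_eq_zero]
    intro v hv
    by_contra hv₀
    have hvv : g v v = 0 := DFunLike.congr_fun hv v
    exact (hg v hv₀).ne' hvv
  have hdim : Module.finrank ℝ E = Module.finrank ℝ (E →L[ℝ] ℝ) := by
    rw [← LinearMap.toContinuousLinearMap.finrank_eq]
    exact Subspace.dual_finrank_eq.symm
  exact ⟨(LinearEquiv.ofInjectiveOfFinrankEq _ hinj hdim).toContinuousLinearEquiv, rfl⟩

section MetricTrace

variable [FiniteDimensional ℝ E] {g : E →L[ℝ] E →L[ℝ] ℝ}

theorem metricTrace_eq_trace (hg : g.IsInvertible) {B : E →ₗ[ℝ] E →ₗ[ℝ] ℝ} {A : E →ₗ[ℝ] E}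
    (hA : ∀ u w, g (A u) w = B u w) : metricTrace g B = LinearMap.trace ℝ E A := by
  rw [metricTrace]
  congr 1
  ext u
  exact (hg.inverse_apply_eq).2 (ContinuousLinearMap.ext fun w => (hA u w).symm)

theorem exists_endomorphism_metric_eq (hg : g.IsInvertible) (B : E →ₗ[ℝ] E →ₗ[ℝ] ℝ) :
    ∃ A : E →ₗ[ℝ] E, ∀ u w, g (A u) w = B u w :=
  ⟨(g.inverse : (E →L[ℝ] ℝ) →ₗ[ℝ] E) ∘ₗ LinearMap.toContinuousLinearMap.toLinearMap ∘ₗ B,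
    fun _ w => DFunLike.congr_fun (hg.self_apply_inverse _) w⟩

theorem metricTrace_sub (g : E →L[ℝ] E →L[ℝ] ℝ) (B C : E →ₗ[ℝ] E →ₗ[ℝ] ℝ) :
    metricTrace g (B - C) = metricTrace g B - metricTrace g C := by
  simp only [metricTrace, LinearMap.comp_sub, map_sub]

theorem metricTrace_smul (g : E →L[ℝ] E →L[ℝ] ℝ) (c : ℝ) (B : E →ₗ[ℝ] E →ₗ[ℝ] ℝ) :
    metricTrace g (c • B) = c * metricTrace g B := by
  simp only [metricTrace, LinearMap.comp_smul, map_smul, smul_eq_mul]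

end MetricTrace

theorem isInvertible_smul_mul {c : ℝ} (hc : c ≠ 0) :
    (c • ContinuousLinearMap.mul ℝ ℝ).IsInvertible := by
  refine .of_inverse (g := c⁻¹ • ContinuousLinearMap.apply ℝ ℝ (1 : ℝ)) ?_ ?_ <;> ext <;> simp [hc]

theorem metricTrace_smul_mul {c : ℝ} (hc : c ≠ 0) (B : ℝ →ₗ[ℝ] ℝ →ₗ[ℝ] ℝ) :
    metricTrace (c • ContinuousLinearMap.mul ℝ ℝ) B = c⁻¹ * B 1 1 := by
  rw [metricTrace_eq_trace (isInvertible_smul_mul hc) (A := (c⁻¹ * B 1 1) • LinearMap.id)]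
  · simp
  · intro u w
    have hB : B = B 1 1 • LinearMap.mul ℝ ℝ := by ext; simp
    have hBuw : B u w = B 1 1 * (u * w) := DFunLike.congr_fun (DFunLike.congr_fun hB u) w
    change c * (c⁻¹ * B 1 1 * u * w) = _
    rw [hBuw]
    field_simp

section OrthogonalSum

variable {E₁ E₂ : Type*} [NormedAddCommGroup E₁] [NormedSpace ℝ E₁] [NormedAddCommGroup E₂]
  [NormedSpace ℝ E₂]

/-- The bilinear form `g₁ ⊕ g₂` on a product, for which the two factors are orthogonal. -/
def orthogonalSum (g₁ : E₁ →L[ℝ] E₁ →L[ℝ] ℝ) (g₂ : E₂ →L[ℝ] E₂ →L[ℝ] ℝ) :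
    E₁ × E₂ →L[ℝ] E₁ × E₂ →L[ℝ] ℝ :=
  (ContinuousLinearMap.coprodEquivL ℝ).toContinuousLinearMap ∘L g₁.prodMap g₂

variable {g₁ : E₁ →L[ℝ] E₁ →L[ℝ] ℝ} {g₂ : E₂ →L[ℝ] E₂ →L[ℝ] ℝ}

theorem orthogonalSum_apply (V W : E₁ × E₂) :
    orthogonalSum g₁ g₂ V W = g₁ V.1 W.1 + g₂ V.2 W.2 := rfl

theorem isInvertible_orthogonalSum (h₁ : g₁.IsInvertible) (h₂ : g₂.IsInvertible) :
    (orthogonalSum g₁ g₂).IsInvertible := by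
  obtain ⟨e₁, rfl⟩ := h₁
  obtain ⟨e₂, rfl⟩ := h₂
  exact ⟨(e₁.prodCongr e₂).trans (ContinuousLinearMap.coprodEquivL ℝ), rfl⟩

theorem metricTrace_orthogonalSum [FiniteDimensional ℝ E₁] [FiniteDimensional ℝ E₂]
    (h₁ : g₁.IsInvertible) (h₂ : g₂.IsInvertible) (B : E₁ × E₂ →ₗ[ℝ] E₁ × E₂ →ₗ[ℝ] ℝ) :
    metricTrace (orthogonalSum g₁ g₂) B =
      metricTrace g₁ (B.compl₁₂ (.inl ℝ E₁ E₂) (.inl ℝ E₁ E₂)) +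
        metricTrace g₂ (B.compl₁₂ (.inr ℝ E₁ E₂) (.inr ℝ E₁ E₂)) := by
  have h := isInvertible_orthogonalSum h₁ h₂
  obtain ⟨A, hA⟩ := exists_endomorphism_metric_eq h B
  rw [metricTrace_eq_trace h hA, trace_prod]
  congr 1
  · refine (metricTrace_eq_trace h₁ fun u w => ?_).symm
    simpa [orthogonalSum_apply] using hA (u, 0) (w, 0)
  · refine (metricTrace_eq_trace h₂ fun u w => ?_).symm
    simpa [orthogonalSum_apply] using hA (0, u) (0, w)

theorem contDiff_orthogonalSum {n : ℕ∞ω} :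
    ContDiff ℝ n fun g : (E₁ →L[ℝ] E₁ →L[ℝ] ℝ) × (E₂ →L[ℝ] E₂ →L[ℝ] ℝ) =>
      orthogonalSum g.1 g.2 :=
  contDiff_const.clm_comp
    (ContinuousLinearMap.prodMapL ℝ E₁ (E₁ →L[ℝ] ℝ) E₂ (E₂ →L[ℝ] ℝ)).contDiff

end OrthogonalSum

section ReverseCauchySchwarz

variable {V : Type*} [AddCommGroup V] [Module ℝ V] {B : LinearMap.BilinForm ℝ V}

theorem abs_apply_le_of_apply_self_le_sq (hsymm : LinearMap.IsSymm B) (hpos : ∀ v, 0 ≤ B v v)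
    {a b : ℝ} {v w : V} (hv : B v v ≤ a ^ 2) (hw : B w w ≤ b ^ 2) : |B v w| ≤ |a * b| := by
  rw [← sq_le_sq, mul_pow]
  exact (B.apply_sq_le_of_symm hpos hsymm v w).trans
    (mul_le_mul hv hw (hpos w) (sq_nonneg a))

theorem mul_pos_of_apply_lt_mul (hsymm : LinearMap.IsSymm B) (hpos : ∀ v, 0 ≤ B v v)
    {a b : ℝ} {v w : V} (hv : B v v ≤ a ^ 2) (hw : B w w ≤ b ^ 2) (hvw : B v w < a * b) :
    0 < a * b := by
  by_contra! hab
  have habs := abs_apply_le_of_apply_self_le_sq hsymm hpos hv hw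
  rw [abs_of_nonpos hab] at habs
  linarith [(abs_le.1 habs).1]

theorem apply_le_mul_of_apply_lt_mul (hsymm : LinearMap.IsSymm B) (hpos : ∀ v, 0 ≤ B v v)
    {a b₁ b₂ : ℝ} {z w₁ w₂ : V} (hz : B z z ≤ a ^ 2) (h₁ : B w₁ w₁ ≤ b₁ ^ 2)
    (h₂ : B w₂ w₂ ≤ b₂ ^ 2) (hz₁ : B z w₁ < a * b₁) (hz₂ : B z w₂ < a * b₂) :
    B w₁ w₂ ≤ b₁ * b₂ := by
  have hab₁ : 0 < a * b₁ := mul_pos_of_apply_lt_mul hsymm hpos hz h₁ hz₁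
  have hab₂ : 0 < a * b₂ := mul_pos_of_apply_lt_mul hsymm hpos hz h₂ hz₂
  have hb : 0 ≤ b₁ * b₂ := by
    rw [← mul_nonneg_iff_of_pos_left (mul_self_pos.2 (left_ne_zero_of_mul hab₁.ne'))]
    linarith [mul_pos hab₁ hab₂]
  rw [← abs_of_nonneg hb]
  exact (le_abs_self _).trans (abs_apply_le_of_apply_self_le_sq hsymm hpos h₁ h₂)

end ReverseCauchySchwarz

end LinearAlgebra

section CoordinateGeometry

variable {E : Type*} [NormedAddCommGroup E] [NormedSpace ℝ E]

theorem fderiv_clm_apply_apply {X E₁ E₂ E₃ : Type*} [NormedAddCommGroup X] [NormedSpace ℝ X]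
    [NormedAddCommGroup E₁] [NormedSpace ℝ E₁] [NormedAddCommGroup E₂] [NormedSpace ℝ E₂]
    [NormedAddCommGroup E₃] [NormedSpace ℝ E₃] {B : X → E₁ →L[ℝ] E₂ →L[ℝ] E₃} {x : X}
    (hB : DifferentiableAt ℝ B x) (a : E₁) (b : E₂) (u : X) :
    fderiv ℝ (fun z => B z a b) x u = fderiv ℝ B x u a b := by
  have hBa : DifferentiableAt ℝ (fun z => B z a) x := hB.clm_apply (differentiableAt_const a)
  rw [fderiv_clm_apply hBa (differentiableAt_const b), fderiv_clm_apply hB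
    (differentiableAt_const a)]
  simp

variable {G : E → E →L[ℝ] E →L[ℝ] ℝ} {h : E → ℝ} {y : E}

theorem christoffel_congr {G' : E → E →L[ℝ] E →L[ℝ] ℝ} (hG : G =ᶠ[𝓝 y] G') :
    christoffel G =ᶠ[𝓝 y] christoffel G' := by
  filter_upwards [hG, hG.fderiv (𝕜 := ℝ)] with z hz hz'
  simp only [christoffel, christoffelFirst, hz, hz']

theorem coordRicci_congr {G' : E → E →L[ℝ] E →L[ℝ] ℝ} (hG : G =ᶠ[𝓝 y] G') :
    coordRicci G y = coordRicci G' y := by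
  have hΓ := christoffel_congr hG
  simp only [coordRicci, curvatureEnd, hΓ.eq_of_nhds, hΓ.fderiv_eq]

theorem christoffel_eq_iff (hinv : (G y).IsInvertible) {u v X : E} :
    christoffel G y u v = X ↔ ∀ w, christoffelFirst G y u v w = G y X w := by
  rw [christoffel_apply, hinv.inverse_apply_eq, ContinuousLinearMap.ext_iff]

theorem metric_christoffel (hinv : (G y).IsInvertible) (u v w : E) :
    G y (christoffel G y u v) w = christoffelFirst G y u v w :=
  ((christoffel_eq_iff hinv).1 rfl w).symm

theorem fderiv_metric_symm (hG : DifferentiableAt ℝ G y)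
    (hsymm : ∀ᶠ z in 𝓝 y, ∀ u v, G z u v = G z v u) (w u v : E) :
    fderiv ℝ G y w u v = fderiv ℝ G y w v u := by
  rw [← fderiv_clm_apply_apply hG, ← fderiv_clm_apply_apply hG]
  have heq : (fun z => G z u v) =ᶠ[𝓝 y] fun z => G z v u := hsymm.mono fun z hz => hz u v
  rw [heq.fderiv_eq]

theorem fderiv_metric_eq_christoffel (hG : DifferentiableAt ℝ G y)
    (hsymm : ∀ᶠ z in 𝓝 y, ∀ u v, G z u v = G z v u) (hinv : (G y).IsInvertible) (u v w : E) :
    fderiv ℝ G y u v w = G y (christoffel G y u v) w + G y (christoffel G y u w) v := by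
  simp only [metric_christoffel hinv, christoffelFirst_apply, fderiv_metric_symm hG hsymm u w v,
    fderiv_metric_symm hG hsymm v u w, fderiv_metric_symm hG hsymm w u v]
  ring

/-- The gradient of `h` with respect to the metric `G`. -/
def coordGrad (G : E → E →L[ℝ] E →L[ℝ] ℝ) (h : E → ℝ) (y : E) : E :=
  (G y).inverse (fderiv ℝ h y)

theorem metric_coordGrad (hinv : (G y).IsInvertible) : G y (coordGrad G h y) = fderiv ℝ h y :=
  hinv.self_apply_inverse _

/-- The Levi-Civita covariant derivative `u ↦ ∇ᵤ X = ∂ᵤ X + Γ(u, X)` of a vector field `X`. -/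
def coordCovariantDeriv (G : E → E →L[ℝ] E →L[ℝ] ℝ) (X : E → E) (y : E) : E →L[ℝ] E :=
  fderiv ℝ X y + (christoffel G y).flip (X y)

theorem coordCovariantDeriv_apply (X : E → E) (u : E) :
    coordCovariantDeriv G X y u = fderiv ℝ X y u + christoffel G y u (X y) := rfl

theorem coordHessian_apply (u v : E) :
    coordHessian G h y u v =
      fderiv ℝ (fderiv ℝ h) y u v - fderiv ℝ h y (christoffel G y u v) := rfl

section Complete

variable [CompleteSpace E]

theorem eventually_isInvertible (hG : ContinuousAt G y) (hinv : (G y).IsInvertible) :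
    ∀ᶠ z in 𝓝 y, (G z).IsInvertible := by
  obtain ⟨e, he⟩ := hinv
  exact hG.eventually (he ▸ e.nhds)

theorem differentiableAt_inverse (hG : DifferentiableAt ℝ G y) (hinv : (G y).IsInvertible) :
    DifferentiableAt ℝ (fun z => (G z).inverse) y :=
  ((hinv.contDiffAt_map_inverse (n := 1)).differentiableAt one_ne_zero).comp y hG

theorem differentiableAt_christoffel (hG : ContDiffAt ℝ 2 G y) (hinv : (G y).IsInvertible) :
    DifferentiableAt ℝ (christoffel G) y := by
  have hD : DifferentiableAt ℝ (fderiv ℝ G) y :=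
    (hG.fderiv_right (m := 1) le_rfl).differentiableAt one_ne_zero
  have hflip : DifferentiableAt ℝ (fun z => (fderiv ℝ G z).flip) y :=
    (ContinuousLinearMap.flipₗᵢ ℝ E E
      (E →L[ℝ] ℝ)).toContinuousLinearEquiv.differentiableAt.comp y hD
  have hfirst : DifferentiableAt ℝ (christoffelFirst G) y :=
    ((hD.add hflip).sub ((differentiableAt_const _).clm_comp hflip)).const_smul (1 / 2 : ℝ)
  have hinverse := differentiableAt_inverse (hG.differentiableAt two_ne_zero) hinv
  exact ((ContinuousLinearMap.compL ℝ E (E →L[ℝ] ℝ) E).differentiableAt.comp y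
    hinverse).clm_comp hfirst

theorem differentiableAt_coordGrad (hG : DifferentiableAt ℝ G y)
    (hh : DifferentiableAt ℝ (fderiv ℝ h) y) (hinv : (G y).IsInvertible) :
    DifferentiableAt ℝ (coordGrad G h) y :=
  (differentiableAt_inverse hG hinv).clm_apply hh

theorem metric_coordCovariantDeriv_coordGrad (hG : DifferentiableAt ℝ G y)
    (hh : DifferentiableAt ℝ (fderiv ℝ h) y)
    (hsymm : ∀ᶠ z in 𝓝 y, ∀ u v, G z u v = G z v u) (hinv : (G y).IsInvertible) (u w : E) :
    G y (coordCovariantDeriv G (coordGrad G h) y u) w = coordHessian G h y u w := by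
  have hgrad := differentiableAt_coordGrad hG hh hinv
  have hderiv : (fun z => G z (coordGrad G h z)) =ᶠ[𝓝 y] fderiv ℝ h :=
    (eventually_isInvertible hG.continuousAt hinv).mono fun z hz => metric_coordGrad hz
  have hproduct : fderiv ℝ (fderiv ℝ h) y u w =
      G y (fderiv ℝ (coordGrad G h) y u) w + fderiv ℝ G y u (coordGrad G h y) w := by
    rw [← hderiv.fderiv_eq, fderiv_clm_apply hG hgrad]
    rfl
  rw [coordHessian_apply, hproduct, fderiv_metric_eq_christoffel hG hsymm hinv,
    hsymm.self_of_nhds (christoffel G y u w), metric_coordGrad hinv, coordCovariantDeriv_apply,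
    map_add, add_apply]
  ring

end Complete

theorem metricTrace_coordHessian [FiniteDimensional ℝ E] (hG : DifferentiableAt ℝ G y)
    (hh : DifferentiableAt ℝ (fderiv ℝ h) y)
    (hsymm : ∀ᶠ z in 𝓝 y, ∀ u v, G z u v = G z v u) (hinv : (G y).IsInvertible) :
    metricTrace (G y) (coordHessian G h y) =
      LinearMap.trace ℝ E (coordCovariantDeriv G (coordGrad G h) y : E →ₗ[ℝ] E) :=
  have : CompleteSpace E := FiniteDimensional.complete ℝ E
  metricTrace_eq_trace hinv (metric_coordCovariantDeriv_coordGrad hG hh hsymm hinv)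

end CoordinateGeometry

section StaticCoordinates

variable {E : Type*} [NormedAddCommGroup E] [NormedSpace ℝ E]

/-- The metric `-φ² dt² + G` on `ℝ × E`: a standard static metric in coordinates. -/
def staticCoord (G : E → E →L[ℝ] E →L[ℝ] ℝ) (φ : E → ℝ) (q : ℝ × E) :
    ℝ × E →L[ℝ] ℝ × E →L[ℝ] ℝ :=
  orthogonalSum (-φ q.2 ^ 2 • ContinuousLinearMap.mul ℝ ℝ) (G q.2)

/-- The logarithmic differential `dφ / φ`, which gives the mixed Christoffel symbols of the metric
`-φ² dt² + G`. -/
def logDifferential (φ : E → ℝ) (y : E) : E →L[ℝ] ℝ := (φ y)⁻¹ • fderiv ℝ φ y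

/-- The vector `∇_{∂ₜ} ∂ₜ = φ grad φ` of the metric `-φ² dt² + G`. -/
def timeAcceleration (G : E → E →L[ℝ] E →L[ℝ] ℝ) (φ : E → ℝ) (y : E) : E :=
  φ y • coordGrad G φ y

variable {G : E → E →L[ℝ] E →L[ℝ] ℝ} {φ : E → ℝ} {y : E} {q : ℝ × E}

theorem staticCoord_apply (V W : ℝ × E) :
    staticCoord G φ q V W = -φ q.2 ^ 2 * (V.1 * W.1) + G q.2 V.2 W.2 := rfl

theorem isInvertible_staticCoord (hinv : (G q.2).IsInvertible) (hφ₀ : φ q.2 ≠ 0) :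
    (staticCoord G φ q).IsInvertible :=
  isInvertible_orthogonalSum (isInvertible_smul_mul (neg_ne_zero.2 (pow_ne_zero 2 hφ₀))) hinv

theorem contDiffAt_staticCoord {n : ℕ∞ω} (hG : ContDiffAt ℝ n G q.2)
    (hφ : ContDiffAt ℝ n φ q.2) : ContDiffAt ℝ n (staticCoord G φ) q :=
  ((contDiff_orthogonalSum (E₁ := ℝ) (E₂ := E)).contDiffAt.comp q.2
    (((hφ.pow 2).neg.smul contDiffAt_const).prodMk hG)).comp q contDiffAt_snd

theorem differentiableAt_staticCoord (hG : DifferentiableAt ℝ G q.2)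
    (hφ : DifferentiableAt ℝ φ q.2) : DifferentiableAt ℝ (staticCoord G φ) q :=
  (((contDiff_orthogonalSum (E₁ := ℝ) (E₂ := E) (n := 1)).differentiable one_ne_zero _).comp q.2
    (((hφ.pow 2).neg.smul_const (ContinuousLinearMap.mul ℝ ℝ)).prodMk hG)).comp q
      differentiableAt_snd

theorem fderiv_staticCoord (hG : DifferentiableAt ℝ G q.2) (hφ : DifferentiableAt ℝ φ q.2)
    (U V W : ℝ × E) :
    fderiv ℝ (staticCoord G φ) q U V W =
      -(2 * φ q.2 * fderiv ℝ φ q.2 U.2) * (V.1 * W.1) + fderiv ℝ G q.2 U.2 V.2 W.2 := by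
  have hφ' : HasFDerivAt (fun z => -φ z ^ 2 * (V.1 * W.1)) _ q.2 :=
    (hφ.hasFDerivAt.pow 2).neg.mul_const _
  have hG' : DifferentiableAt ℝ (fun z => G z V.2 W.2) q.2 :=
    (hG.clm_apply (differentiableAt_const _)).clm_apply (differentiableAt_const _)
  have hsum := (hφ'.add hG'.hasFDerivAt).comp q hasFDerivAt_snd
  rw [← fderiv_clm_apply_apply (differentiableAt_staticCoord hG hφ),
    ← fderiv_clm_apply_apply hG]
  refine (DFunLike.congr_fun hsum.fderiv U).trans ?_
  simp only [Nat.add_one_sub_one, pow_one, nsmul_eq_mul, Nat.cast_ofNat, smul_neg,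
    ContinuousLinearMap.add_comp, ContinuousLinearMap.neg_comp, ContinuousLinearMap.smul_comp,
    add_apply, neg_apply, smul_apply, ContinuousLinearMap.comp_apply,
    ContinuousLinearMap.coe_snd', smul_eq_mul]
  ring

theorem christoffel_staticCoord (hG : DifferentiableAt ℝ G q.2) (hφ : DifferentiableAt ℝ φ q.2)
    (hinv : (G q.2).IsInvertible) (hφ₀ : φ q.2 ≠ 0) (V W : ℝ × E) :
    christoffel (staticCoord G φ) q V W =
      (V.1 * logDifferential φ q.2 W.2 + W.1 * logDifferential φ q.2 V.2,
        christoffel G q.2 V.2 W.2 + (V.1 * W.1) • timeAcceleration G φ q.2) := by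
  rw [christoffel_eq_iff (isInvertible_staticCoord hinv hφ₀)]
  intro Z
  simp only [christoffelFirst_apply, fderiv_staticCoord hG hφ, staticCoord_apply, map_add,
    map_smul, add_apply, smul_apply, timeAcceleration, logDifferential, metric_christoffel hinv,
    metric_coordGrad hinv, smul_eq_mul]
  field_simp
  ring

theorem differentiableAt_logDifferential (hφ : ContDiffAt ℝ 2 φ y) (hφ₀ : φ y ≠ 0) :
    DifferentiableAt ℝ (logDifferential φ) y :=
  ((hφ.differentiableAt two_ne_zero).inv hφ₀).smul
    ((hφ.fderiv_right (m := 1) le_rfl).differentiableAt one_ne_zero)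

theorem differentiableAt_timeAcceleration [CompleteSpace E] (hG : DifferentiableAt ℝ G y)
    (hφ : ContDiffAt ℝ 2 φ y) (hinv : (G y).IsInvertible) :
    DifferentiableAt ℝ (timeAcceleration G φ) y :=
  (hφ.differentiableAt two_ne_zero).smul (differentiableAt_coordGrad hG
    ((hφ.fderiv_right (m := 1) le_rfl).differentiableAt one_ne_zero) hinv)

theorem fderiv_christoffel_staticCoord [CompleteSpace E] (hG : ContDiffAt ℝ 2 G q.2)
    (hφ : ContDiffAt ℝ 2 φ q.2) (hinv : (G q.2).IsInvertible) (hφ₀ : φ q.2 ≠ 0)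
    (U V W : ℝ × E) :
    fderiv ℝ (christoffel (staticCoord G φ)) q U V W =
      (V.1 * fderiv ℝ (logDifferential φ) q.2 U.2 W.2 +
          W.1 * fderiv ℝ (logDifferential φ) q.2 U.2 V.2,
        fderiv ℝ (christoffel G) q.2 U.2 V.2 W.2 +
          (V.1 * W.1) • fderiv ℝ (timeAcceleration G φ) q.2 U.2) := by
  have hΓ := differentiableAt_christoffel hG hinv
  have hθ := differentiableAt_logDifferential hφ hφ₀
  have hN := differentiableAt_timeAcceleration (hG.differentiableAt two_ne_zero) hφ hinv
  have hΓVW : DifferentiableAt ℝ (fun z => christoffel G z V.2 W.2) q.2 :=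
    (hΓ.clm_apply (differentiableAt_const _)).clm_apply (differentiableAt_const _)
  have hθw (w : E) : HasFDerivAt (fun z => logDifferential φ z w) _ q.2 :=
    hθ.hasFDerivAt.clm_apply (hasFDerivAt_const w q.2)
  have hformula : (fun q' => christoffel (staticCoord G φ) q' V W) =ᶠ[𝓝 q] fun q' =>
      (V.1 * logDifferential φ q'.2 W.2 + W.1 * logDifferential φ q'.2 V.2,
        christoffel G q'.2 V.2 W.2 + (V.1 * W.1) • timeAcceleration G φ q'.2) := by
    have hsnd : Filter.Tendsto (Prod.snd : ℝ × E → E) (𝓝 q) (𝓝 q.2) := continuous_snd.tendsto q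
    filter_upwards [hsnd.eventually (hG.eventually (by simp)),
      hsnd.eventually (hφ.eventually (by simp)),
      hsnd.eventually (eventually_isInvertible hG.continuousAt hinv),
      hsnd.eventually (hφ.continuousAt.eventually_ne hφ₀)] with q' hG' hφ' hinv' hφ₀'
    exact christoffel_staticCoord (hG'.differentiableAt two_ne_zero)
      (hφ'.differentiableAt two_ne_zero) hinv' hφ₀' V W
  have hderiv := ((((hθw W.2).const_mul V.1).add ((hθw V.2).const_mul W.1)).prodMk
    (hΓVW.hasFDerivAt.add (hN.hasFDerivAt.const_smul (V.1 * W.1)))).comp q hasFDerivAt_snd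
  rw [← fderiv_clm_apply_apply (differentiableAt_christoffel (contDiffAt_staticCoord hG hφ)
    (isInvertible_staticCoord hinv hφ₀)), ← fderiv_clm_apply_apply hΓ]
  refine (DFunLike.congr_fun (hderiv.congr_of_eventuallyEq hformula).fderiv U).trans ?_
  simp

theorem inv_mul_coordHessian (hφ : ContDiffAt ℝ 2 φ y) (hφ₀ : φ y ≠ 0) (v w : E) :
    (φ y)⁻¹ * coordHessian G φ y v w =
      fderiv ℝ (logDifferential φ) y v w + logDifferential φ y v * logDifferential φ y w -
        logDifferential φ y (christoffel G y v w) := by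
  have hdφ : fderiv ℝ φ =ᶠ[𝓝 y] fun z => φ z • logDifferential φ z := by
    filter_upwards [hφ.continuousAt.eventually_ne hφ₀] with z hz
    rw [logDifferential, smul_inv_smul₀ hz]
  have hddφ : fderiv ℝ (fderiv ℝ φ) y v w =
      φ y * fderiv ℝ (logDifferential φ) y v w + fderiv ℝ φ y v * logDifferential φ y w := by
    rw [hdφ.fderiv_eq, fderiv_fun_smul (hφ.differentiableAt two_ne_zero)
      (differentiableAt_logDifferential hφ hφ₀)]
    rfl
  rw [coordHessian_apply, hddφ]
  simp only [logDifferential, smul_apply, smul_eq_mul]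
  field_simp

theorem coordCovariantDeriv_timeAcceleration [CompleteSpace E] (hG : DifferentiableAt ℝ G y)
    (hφ : ContDiffAt ℝ 2 φ y) (hinv : (G y).IsInvertible) (hφ₀ : φ y ≠ 0) (u : E) :
    coordCovariantDeriv G (timeAcceleration G φ) y u =
      φ y • coordCovariantDeriv G (coordGrad G φ) y u +
        logDifferential φ y u • timeAcceleration G φ y := by
  have hgrad := differentiableAt_coordGrad hG
    ((hφ.fderiv_right (m := 1) le_rfl).differentiableAt one_ne_zero) hinv
  have hderiv : fderiv ℝ (timeAcceleration G φ) y u =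
      φ y • fderiv ℝ (coordGrad G φ) y u + fderiv ℝ φ y u • coordGrad G φ y := by
    change fderiv ℝ (fun z => φ z • coordGrad G φ z) y u = _
    rw [fderiv_fun_smul (hφ.differentiableAt two_ne_zero) hgrad]
    rfl
  simp only [coordCovariantDeriv_apply, hderiv, timeAcceleration, logDifferential, map_smul,
    smul_apply, smul_eq_mul]
  match_scalars <;> simp [field]

theorem curvatureEnd_staticCoord_time [CompleteSpace E] (hG : ContDiffAt ℝ 2 G q.2)
    (hφ : ContDiffAt ℝ 2 φ q.2) (hinv : (G q.2).IsInvertible) (hφ₀ : φ q.2 ≠ 0) (V W : ℝ × E) :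
    (curvatureEnd (staticCoord G φ) q V W (1, 0)).1 =
      -((φ q.2)⁻¹ * coordHessian G φ q.2 V.2 W.2) := by
  simp only [inv_mul_coordHessian hφ hφ₀, curvatureEnd_apply,
    fderiv_christoffel_staticCoord hG hφ hinv hφ₀,
    christoffel_staticCoord (hG.differentiableAt two_ne_zero) (hφ.differentiableAt two_ne_zero)
      hinv hφ₀, Prod.fst_add, Prod.fst_sub, map_add, map_smul, map_zero, zero_apply, smul_eq_mul]
  ring

theorem curvatureEnd_staticCoord_space [CompleteSpace E] (hG : ContDiffAt ℝ 2 G q.2)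
    (hφ : ContDiffAt ℝ 2 φ q.2) (hinv : (G q.2).IsInvertible) (hφ₀ : φ q.2 ≠ 0) (V W : ℝ × E)
    (u : E) :
    (curvatureEnd (staticCoord G φ) q V W (0, u)).2 =
      curvatureEnd G q.2 V.2 W.2 u +
        (V.1 * W.1 * φ q.2) • coordCovariantDeriv G (coordGrad G φ) q.2 u := by
  have hG₁ : DifferentiableAt ℝ G q.2 := hG.differentiableAt two_ne_zero
  have hN := coordCovariantDeriv_timeAcceleration hG₁ hφ hinv hφ₀ u
  rw [mul_smul, ← sub_eq_of_eq_add hN]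
  simp only [curvatureEnd_apply, coordCovariantDeriv_apply,
    fderiv_christoffel_staticCoord hG hφ hinv hφ₀,
    christoffel_staticCoord hG₁ (hφ.differentiableAt two_ne_zero) hinv hφ₀, Prod.snd_add,
    Prod.snd_sub, map_add, map_smul]
  module

theorem coordRicci_staticCoord [FiniteDimensional ℝ E] (hG : ContDiffAt ℝ 2 G q.2)
    (hφ : ContDiffAt ℝ 2 φ q.2) (hsymm : ∀ᶠ z in 𝓝 q.2, ∀ u v, G z u v = G z v u)
    (hinv : (G q.2).IsInvertible) (hφ₀ : φ q.2 ≠ 0) (V W : ℝ × E) :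
    coordRicci (staticCoord G φ) q V W =
      coordRicci G q.2 V.2 W.2 - (φ q.2)⁻¹ * coordHessian G φ q.2 V.2 W.2 +
        V.1 * W.1 * φ q.2 * metricTrace (G q.2) (coordHessian G φ q.2) := by
  have : CompleteSpace E := FiniteDimensional.complete ℝ E
  have htime : (.fst ℝ ℝ E ∘ₗ (curvatureEnd (staticCoord G φ) q V W).toLinearMap ∘ₗ
      .inl ℝ ℝ E : ℝ →ₗ[ℝ] ℝ) =
        (-((φ q.2)⁻¹ * coordHessian G φ q.2 V.2 W.2)) • LinearMap.id := by
    ext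
    simpa using curvatureEnd_staticCoord_time hG hφ hinv hφ₀ V W
  have hspace : (.snd ℝ ℝ E ∘ₗ (curvatureEnd (staticCoord G φ) q V W).toLinearMap ∘ₗ
      .inr ℝ ℝ E : E →ₗ[ℝ] E) = (curvatureEnd G q.2 V.2 W.2).toLinearMap +
        (V.1 * W.1 * φ q.2) • (coordCovariantDeriv G (coordGrad G φ) q.2).toLinearMap :=
    LinearMap.ext fun u => curvatureEnd_staticCoord_space hG hφ hinv hφ₀ V W u
  rw [metricTrace_coordHessian (hG.differentiableAt two_ne_zero)
    ((hφ.fderiv_right (m := 1) le_rfl).differentiableAt one_ne_zero) hsymm hinv]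
  simp only [coordRicci, LinearMap.mk₂_apply, trace_prod, htime, hspace, map_add, map_smul,
    LinearMap.trace_id, Module.finrank_self, Nat.cast_one, smul_eq_mul]
  ring

theorem metricTrace_coordRicci_staticCoord [FiniteDimensional ℝ E] (hG : ContDiffAt ℝ 2 G q.2)
    (hφ : ContDiffAt ℝ 2 φ q.2) (hsymm : ∀ᶠ z in 𝓝 q.2, ∀ u v, G z u v = G z v u)
    (hinv : (G q.2).IsInvertible) (hφ₀ : φ q.2 ≠ 0) :
    metricTrace (staticCoord G φ q) (coordRicci (staticCoord G φ) q) =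
      metricTrace (G q.2) (coordRicci G q.2) -
        2 * (φ q.2)⁻¹ * metricTrace (G q.2) (coordHessian G φ q.2) := by
  have hc : -φ q.2 ^ 2 ≠ 0 := neg_ne_zero.2 (pow_ne_zero 2 hφ₀)
  have hspace : (coordRicci (staticCoord G φ) q).compl₁₂ (.inr ℝ ℝ E) (.inr ℝ ℝ E) =
      coordRicci G q.2 - (φ q.2)⁻¹ • coordHessian G φ q.2 := by
    ext v w
    simp [coordRicci_staticCoord hG hφ hsymm hinv hφ₀]
  have htime : coordRicci (staticCoord G φ) q (1, 0) (1, 0) =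
      φ q.2 * metricTrace (G q.2) (coordHessian G φ q.2) := by
    simp [coordRicci_staticCoord hG hφ hsymm hinv hφ₀]
  rw [staticCoord, metricTrace_orthogonalSum (isInvertible_smul_mul hc) hinv,
    metricTrace_smul_mul hc, hspace, metricTrace_sub, metricTrace_smul]
  simp only [LinearMap.compl₁₂_apply, LinearMap.inl_apply, htime]
  field_simp
  ring

end StaticCoordinates

section Charts

variable {E : Type*} [NormedAddCommGroup E] [NormedSpace ℝ E]
  {H : Type*} [TopologicalSpace H] {I : ModelWithCorners ℝ E H}
  {N : Type*} [TopologicalSpace N] [ChartedSpace H N]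

section Riemannian

variable {n : ℕ∞ω} [IsManifold I 1 N]
  (g : Bundle.ContMDiffRiemannianMetric I n E (fun x : N => TangentSpace I x))

theorem inner_self_nonneg (x : N) (v : TangentSpace I x) : 0 ≤ g.inner x v v := by
  obtain rfl | hv := eq_or_ne v 0
  · rw [map_zero]
  · exact (g.pos x v hv).le

theorem isSymm_inner (x : N) : LinearMap.IsSymm (ContinuousLinearMap.toBilinForm (g.inner x)) :=
  ⟨g.symm x⟩

end Riemannian

theorem surjective_chartDeriv [IsManifold I 1 N] (x : N) :
    Function.Surjective (chartDeriv I x) :=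
  (isInvertible_mfderiv_extChartAt (mem_extChartAt_source x)).surjective

theorem scalarCurvature_eq_zero_of_ricci [FiniteDimensional ℝ E] [IsManifold I 1 N]
    {g : MetricField I N} {x : N} (hR : ∀ v w, ricci I g x v w = 0) :
    scalarCurvature I g x = 0 := by
  have hcoord : coordRicci (coordMetric I g x) (extChartAt I x x) = 0 := by
    refine LinearMap.ext fun v => LinearMap.ext fun w => ?_
    obtain ⟨v, rfl⟩ := surjective_chartDeriv (I := I) x v
    obtain ⟨w, rfl⟩ := surjective_chartDeriv (I := I) x w
    exact hR v w
  rw [scalarCurvature, hcoord, metricTrace, LinearMap.comp_zero, LinearMap.comp_zero, map_zero]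

variable [I.Boundaryless]

theorem coordMetric_apply (g : MetricField I N) (x : N) (y V W : E) :
    coordMetric I g x y V W =
      g ((extChartAt I x).symm y) (mfderiv 𝓘(ℝ, E) I (extChartAt I x).symm y V)
        (mfderiv 𝓘(ℝ, E) I (extChartAt I x).symm y W) := by
  rw [← mfderivWithin_univ, ← I.range_eq_univ]
  rfl

theorem contMDiffAt_extChartAt_symm {n : ℕ∞ω} [IsManifold I n N] {x : N} {y : E}
    (hy : y ∈ (extChartAt I x).target) : ContMDiffAt 𝓘(ℝ, E) I n (extChartAt I x).symm y :=
  (contMDiffOn_extChartAt_symm x).contMDiffAt (extChartAt_target_mem_nhds' hy)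

theorem mdifferentiableAt_extChartAt_symm [IsManifold I 1 N] {x : N} {y : E}
    (hy : y ∈ (extChartAt I x).target) :
    MDifferentiableAt 𝓘(ℝ, E) I (extChartAt I x).symm y :=
  (contMDiffAt_extChartAt_symm hy).mdifferentiableAt one_ne_zero

theorem contDiffAt_comp_extChartAt_symm {n : ℕ∞ω} [IsManifold I n N] {h : N → ℝ}
    (hh : ContMDiff I 𝓘(ℝ, ℝ) n h) (x : N) :
    ContDiffAt ℝ n (h ∘ (extChartAt I x).symm) (extChartAt I x x) :=
  (hh.contMDiffAt.comp _
    (contMDiffAt_extChartAt_symm (mem_extChartAt_target x))).contDiffAt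

theorem contMDiffAt_mfderiv_extChartAt_symm {m n : ℕ∞ω} [IsManifold I 1 N] [IsManifold I n N]
    (hmn : m + 1 ≤ n) {x : N} {y : E} (hy : y ∈ (extChartAt I x).target) (V : E) :
    ContMDiffAt 𝓘(ℝ, E) I.tangent m (fun z => (⟨(extChartAt I x).symm z,
      mfderiv 𝓘(ℝ, E) I (extChartAt I x).symm z V⟩ : TangentBundle I N)) y := by
  have hopen : IsOpen (extChartAt I x).target := isOpen_extChartAt_target x
  have htangent := (contMDiffOn_extChartAt_symm (I := I) (n := n)
    x).contMDiffOn_tangentMapWithin hmn hopen.uniqueMDiffOn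
  have hconst : ContMDiffOn 𝓘(ℝ, E) 𝓘(ℝ, E).tangent m
      (fun z : E => (⟨z, V⟩ : TangentBundle 𝓘(ℝ, E) E)) (extChartAt I x).target := fun _ _ =>
    (contMDiffAt_vectorSpace_iff_contDiffAt.2 contDiffAt_const).contMDiffWithinAt
  refine ((htangent.comp hconst fun z hz => hz).contMDiffAt
    (hopen.mem_nhds hy)).congr_of_eventuallyEq ?_
  filter_upwards [hopen.mem_nhds hy] with z hz
  simp only [Function.comp_apply, tangentMapWithin, mfderivWithin_of_isOpen hopen hz]

section Riemannian

variable {m : ℕ∞ω} [IsManifold I 1 N]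
  (g : Bundle.ContMDiffRiemannianMetric I m E (fun x : N => TangentSpace I x))

theorem coordMetric_symm (x : N) (y u v : E) :
    coordMetric I g.inner x y u v = coordMetric I g.inner x y v u := by
  rw [coordMetric_apply, coordMetric_apply, g.symm]

variable [FiniteDimensional ℝ E]

theorem isInvertible_coordMetric (x : N) :
    (coordMetric I g.inner x (extChartAt I x x)).IsInvertible := by
  refine isInvertible_of_pos fun v hv => ?_
  have hinv := isInvertible_mfderivWithin_extChartAt_symm (mem_extChartAt_target (I := I) x)
  rw [I.range_eq_univ, mfderivWithin_univ] at hinv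
  rw [coordMetric_apply]
  exact g.pos _ _ ((map_ne_zero_iff _ hinv.injective).2 hv)

theorem contDiffOn_coordMetric {n : ℕ∞ω} [IsManifold I n N] (hmn : m + 1 ≤ n) (x : N) :
    ContDiffOn ℝ m (coordMetric I g.inner x) (extChartAt I x).target := by
  have : IsManifold I m N := .of_le (n := n) (le_self_add.trans hmn)
  refine contDiffOn_clm_apply.2 fun V => contDiffOn_clm_apply.2 fun W y hy => ?_
  have hbundle : ContMDiffAt 𝓘(ℝ, E) (I.prod 𝓘(ℝ)) m
      (fun z ↦ Bundle.TotalSpace.mk' ℝ (E := Bundle.Trivial N ℝ) ((extChartAt I x).symm z)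
        (g.inner ((extChartAt I x).symm z) (mfderiv 𝓘(ℝ, E) I (extChartAt I x).symm z V)
          (mfderiv 𝓘(ℝ, E) I (extChartAt I x).symm z W))) y := by
    apply ContMDiffAt.clm_bundle_apply₂ (F₁ := E) (F₂ := E)
    · exact g.contMDiff.contMDiffAt.comp y (contMDiffAt_extChartAt_symm hy)
    · exact contMDiffAt_mfderiv_extChartAt_symm hmn hy V
    · exact contMDiffAt_mfderiv_extChartAt_symm hmn hy W
  have hcoord := (Bundle.contMDiffAt_totalSpace.1 hbundle).2.contDiffAt
  exact (hcoord.congr_of_eventuallyEq (Filter.Eventually.of_forall fun z =>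
    coordMetric_apply g.inner x z V W)).contDiffWithinAt

theorem contDiffAt_coordMetric {n : ℕ∞ω} [IsManifold I n N] (hmn : m + 1 ≤ n) (x : N) :
    ContDiffAt ℝ m (coordMetric I g.inner x) (extChartAt I x x) :=
  (contDiffOn_coordMetric g hmn x).contDiffAt (extChartAt_target_mem_nhds x)

end Riemannian

end Charts

section StaticCharts

variable {s : ℕ} {t₁ t₂ : EReal} {F : Type*} [TopologicalSpace F]
  [ChartedSpace (EuclideanSpace ℝ (Fin s)) F]

theorem nonempty_openInterval (ht : t₁ < t₂) : Nonempty (openInterval t₁ t₂) :=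
  let ⟨t, h₁, h₂⟩ := EReal.lt_iff_exists_real_btwn.1 ht
  ⟨⟨t, h₁, h₂⟩⟩

theorem extChartAt_openInterval (t t' : openInterval t₁ t₂) :
    extChartAt 𝓘(ℝ, ℝ) t t' = (t' : ℝ) := rfl

theorem coe_extChartAt_symm_openInterval (t : openInterval t₁ t₂) {r : ℝ}
    (hr : r ∈ (extChartAt 𝓘(ℝ, ℝ) t).target) :
    (((extChartAt 𝓘(ℝ, ℝ) t).symm r : openInterval t₁ t₂) : ℝ) = r := by
  rw [← extChartAt_openInterval t, (extChartAt 𝓘(ℝ, ℝ) t).right_inv hr]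

theorem mdifferentiable_openInterval_coe :
    MDifferentiable 𝓘(ℝ, ℝ) 𝓘(ℝ, ℝ) ((↑) : openInterval t₁ t₂ → ℝ) :=
  (contMDiff_subtype_val (n := 1)).mdifferentiable one_ne_zero

theorem mdifferentiable_time :
    MDifferentiable (staticModel s) 𝓘(ℝ, ℝ) fun q : openInterval t₁ t₂ × F => (q.1 : ℝ) :=
  mdifferentiable_openInterval_coe.comp mdifferentiable_fst

theorem extChartAt_static_apply (p q : openInterval t₁ t₂ × F) :
    extChartAt (staticModel s) p q = ((q.1 : ℝ), extChartAt (𝓡 s) p.2 q.2) := by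
  rw [extChartAt_prod, ← extChartAt_openInterval p.1]
  rfl

theorem extChartAt_static_symm_apply (p : openInterval t₁ t₂ × F)
    (q : ℝ × EuclideanSpace ℝ (Fin s)) :
    (extChartAt (staticModel s) p).symm q =
      ((extChartAt 𝓘(ℝ, ℝ) p.1).symm q.1, (extChartAt (𝓡 s) p.2).symm q.2) := by
  rw [extChartAt_prod]
  rfl

variable [IsManifold (𝓡 s) 1 F]

theorem timeForm_extChartAt_symm {p : openInterval t₁ t₂ × F}
    {q : ℝ × EuclideanSpace ℝ (Fin s)} (hq : q ∈ (extChartAt (staticModel s) p).target)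
    (W : ℝ × EuclideanSpace ℝ (Fin s)) :
    timeForm t₁ t₂ ((extChartAt (staticModel s) p).symm q)
      (mfderiv 𝓘(ℝ, ℝ × EuclideanSpace ℝ (Fin s)) (staticModel s)
        (extChartAt (staticModel s) p).symm q W) = W.1 := by
  have heq : (fun q : openInterval t₁ t₂ × F => (q.1 : ℝ)) ∘ (extChartAt (staticModel s) p).symm
      =ᶠ[𝓝 q] Prod.fst := by
    filter_upwards [extChartAt_target_mem_nhds' hq] with z hz
    rw [extChartAt_prod] at hz
    rw [Function.comp_apply, extChartAt_static_symm_apply]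
    exact coe_extChartAt_symm_openInterval p.1 hz.1
  have hcomp := mfderiv_comp q (mdifferentiable_time _) (mdifferentiableAt_extChartAt_symm hq)
  rw [heq.mfderiv_eq, mfderiv_eq_fderiv, fderiv_fst] at hcomp
  exact (DFunLike.congr_fun hcomp W).symm

theorem fiberProj_extChartAt_symm {p : openInterval t₁ t₂ × F}
    {q : ℝ × EuclideanSpace ℝ (Fin s)} (hq : q ∈ (extChartAt (staticModel s) p).target)
    (W : ℝ × EuclideanSpace ℝ (Fin s)) :
    (fiberProj t₁ t₂ ((extChartAt (staticModel s) p).symm q)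
      (mfderiv 𝓘(ℝ, ℝ × EuclideanSpace ℝ (Fin s)) (staticModel s)
        (extChartAt (staticModel s) p).symm q W) : EuclideanSpace ℝ (Fin s)) =
      mfderiv 𝓘(ℝ, EuclideanSpace ℝ (Fin s)) (𝓡 s) (extChartAt (𝓡 s) p.2).symm q.2 W.2 := by
  have hq₂ : q.2 ∈ (extChartAt (𝓡 s) p.2).target := by
    rw [extChartAt_prod] at hq
    exact hq.2
  have heq : Prod.snd ∘ (extChartAt (staticModel s) p).symm =
      (extChartAt (𝓡 s) p.2).symm ∘ Prod.snd := by
    ext z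
    rw [Function.comp_apply, extChartAt_static_symm_apply, Function.comp_apply]
  have hleft := mfderiv_comp q (I' := staticModel s) (I'' := 𝓡 s) (g := Prod.snd)
    mdifferentiableAt_snd (mdifferentiableAt_extChartAt_symm hq)
  have hright := mfderiv_comp q (I := 𝓘(ℝ, ℝ × EuclideanSpace ℝ (Fin s)))
    (mdifferentiableAt_extChartAt_symm hq₂) differentiableAt_snd.mdifferentiableAt
  rw [heq, hright, mfderiv_eq_fderiv, fderiv_snd] at hleft
  exact (DFunLike.congr_fun hleft W).symm

theorem coordMetric_staticMetric (gF : MetricField (𝓡 s) F) (f : F → ℝ)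
    {p : openInterval t₁ t₂ × F} {q : ℝ × EuclideanSpace ℝ (Fin s)}
    (hq : q ∈ (extChartAt (staticModel s) p).target) :
    coordMetric (staticModel s) (staticMetric t₁ t₂ gF f) p q =
      staticCoord (coordMetric (𝓡 s) gF p.2) (f ∘ (extChartAt (𝓡 s) p.2).symm) q := by
  refine ContinuousLinearMap.ext fun V => ContinuousLinearMap.ext fun W => ?_
  rw [coordMetric_apply, staticMetric_apply, timeForm_extChartAt_symm hq,
    timeForm_extChartAt_symm hq, sub_eq_neg_add, ← neg_mul, staticCoord_apply]
  refine congrArg₂ (· + ·) (by rw [extChartAt_static_symm_apply]; rfl)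
    (Eq.trans ?_ (coordMetric_apply gF p.2 q.2 V.2 W.2).symm)
  exact congrArg₂ (fun a b => (gF _ : EuclideanSpace ℝ (Fin s) →L[ℝ]
    EuclideanSpace ℝ (Fin s) →L[ℝ] ℝ) a b)
    (fiberProj_extChartAt_symm hq V) (fiberProj_extChartAt_symm hq W)

theorem coordMetric_staticMetric_eventuallyEq (gF : MetricField (𝓡 s) F) (f : F → ℝ)
    (p : openInterval t₁ t₂ × F) :
    coordMetric (staticModel s) (staticMetric t₁ t₂ gF f) p
      =ᶠ[𝓝 ((p.1 : ℝ), extChartAt (𝓡 s) p.2 p.2)]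
        staticCoord (coordMetric (𝓡 s) gF p.2) (f ∘ (extChartAt (𝓡 s) p.2).symm) := by
  rw [← extChartAt_static_apply]
  filter_upwards [extChartAt_target_mem_nhds p] with q hq using coordMetric_staticMetric gF f hq

theorem chartDeriv_static (p : openInterval t₁ t₂ × F) (w : TangentSpace (staticModel s) p) :
    chartDeriv (staticModel s) p w =
      (timeForm t₁ t₂ p w, chartDeriv (𝓡 s) p.2 (fiberProj t₁ t₂ p w)) := by
  have hsnd : HasMFDerivAt (staticModel s) 𝓘(ℝ, EuclideanSpace ℝ (Fin s))
      (fun q : openInterval t₁ t₂ × F => extChartAt (𝓡 s) p.2 q.2) p _ :=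
    (mdifferentiableAt_extChartAt (mem_chart_source _ _)).hasMFDerivAt.comp p
      (mdifferentiableAt_snd (I := 𝓘(ℝ, ℝ)) (I' := 𝓡 s)).hasMFDerivAt
  have htime : HasMFDerivAt (staticModel s) 𝓘(ℝ, ℝ)
      (fun q : openInterval t₁ t₂ × F => (q.1 : ℝ)) p _ := (mdifferentiable_time p).hasMFDerivAt
  have hprod : HasMFDerivAt (staticModel s) 𝓘(ℝ, ℝ × EuclideanSpace ℝ (Fin s))
      (fun q : openInterval t₁ t₂ × F => ((q.1 : ℝ), extChartAt (𝓡 s) p.2 q.2)) p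
      (ContinuousLinearMap.prod _ _) := ⟨htime.1.prodMk hsnd.1, htime.2.prodMk hsnd.2⟩
  rw [← funext (extChartAt_static_apply p)] at hprod
  have hderiv := hprod.mfderiv
  exact DFunLike.congr_fun hderiv w

end StaticCharts

section StaticCurvature

variable {s : ℕ} {t₁ t₂ : EReal} {F : Type*} [TopologicalSpace F]
  [ChartedSpace (EuclideanSpace ℝ (Fin s)) F] [IsManifold (𝓡 s) 3 F]
  (gF : Bundle.ContMDiffRiemannianMetric (𝓡 s) 2 (EuclideanSpace ℝ (Fin s))
    (fun x : F => TangentSpace (𝓡 s) x)) {f : F → ℝ}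

theorem ricci_staticMetric (hf : ContMDiff (𝓡 s) 𝓘(ℝ, ℝ) 2 f) {p : openInterval t₁ t₂ × F}
    (hf₀ : f p.2 ≠ 0) (w₁ w₂ : TangentSpace (staticModel s) p) :
    ricci (staticModel s) (staticMetric t₁ t₂ gF.inner f) p w₁ w₂ =
      ricci (𝓡 s) gF.inner p.2 (fiberProj t₁ t₂ p w₁) (fiberProj t₁ t₂ p w₂) -
        (f p.2)⁻¹ *
          hessian (𝓡 s) gF.inner f p.2 (fiberProj t₁ t₂ p w₁) (fiberProj t₁ t₂ p w₂) +
        timeForm t₁ t₂ p w₁ * timeForm t₁ t₂ p w₂ * f p.2 * laplacian (𝓡 s) gF.inner f p.2 := by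
  have hfx : (f ∘ (extChartAt (𝓡 s) p.2).symm) (extChartAt (𝓡 s) p.2 p.2) = f p.2 := by simp
  have hcoord := coordRicci_staticCoord (q := ((p.1 : ℝ), extChartAt (𝓡 s) p.2 p.2))
    (contDiffAt_coordMetric gF (n := 3) (by norm_num) p.2) (contDiffAt_comp_extChartAt_symm hf p.2)
    (Filter.Eventually.of_forall (coordMetric_symm gF p.2)) (isInvertible_coordMetric gF p.2)
    (hfx.trans_ne hf₀) (chartDeriv (staticModel s) p w₁) (chartDeriv (staticModel s) p w₂)
  rw [hfx, ← coordRicci_congr (coordMetric_staticMetric_eventuallyEq gF.inner f p)] at hcoord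
  rw [ricci, LinearMap.compl₁₂_apply, extChartAt_static_apply, hcoord, chartDeriv_static,
    chartDeriv_static]
  rfl

theorem scalarCurvature_staticMetric (hf : ContMDiff (𝓡 s) 𝓘(ℝ, ℝ) 2 f)
    {p : openInterval t₁ t₂ × F} (hf₀ : f p.2 ≠ 0) :
    scalarCurvature (staticModel s) (staticMetric t₁ t₂ gF.inner f) p =
      scalarCurvature (𝓡 s) gF.inner p.2 -
        2 * (f p.2)⁻¹ * laplacian (𝓡 s) gF.inner f p.2 := by
  have hfx : (f ∘ (extChartAt (𝓡 s) p.2).symm) (extChartAt (𝓡 s) p.2 p.2) = f p.2 := by simp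
  have hcoord := metricTrace_coordRicci_staticCoord
    (q := ((p.1 : ℝ), extChartAt (𝓡 s) p.2 p.2))
    (contDiffAt_coordMetric gF (n := 3) (by norm_num) p.2) (contDiffAt_comp_extChartAt_symm hf p.2)
    (Filter.Eventually.of_forall (coordMetric_symm gF p.2)) (isInvertible_coordMetric gF p.2)
    (hfx.trans_ne hf₀)
  have heq := coordMetric_staticMetric_eventuallyEq gF.inner f p
  rw [hfx, ← coordRicci_congr heq, ← heq.eq_of_nhds] at hcoord
  rw [scalarCurvature, extChartAt_static_apply, hcoord]
  rfl

theorem energyMomentum_staticMetric (hf : ContMDiff (𝓡 s) 𝓘(ℝ, ℝ) 2 f)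
    {p : openInterval t₁ t₂ × F} (hf₀ : f p.2 ≠ 0) (w₁ w₂ : TangentSpace (staticModel s) p) :
    8 * Real.pi * energyMomentum (staticModel s) (staticMetric t₁ t₂ gF.inner f) p w₁ w₂ =
      -(1 / 2) * scalarCurvature (𝓡 s) gF.inner p.2 * staticMetric t₁ t₂ gF.inner f p w₁ w₂ -
        1 / f p.2 *
          tensorLstar (𝓡 s) gF.inner f p.2 (fiberProj t₁ t₂ p w₁) (fiberProj t₁ t₂ p w₂) := by
  rw [energyMomentum, ricci_staticMetric gF hf hf₀, scalarCurvature_staticMetric gF hf hf₀,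
    staticMetric_apply, tensorLstar]
  field_simp
  ring

end StaticCurvature

section Causality

variable {E : Type*} [NormedAddCommGroup E] [NormedSpace ℝ E]
  {H : Type*} [TopologicalSpace H] {I : ModelWithCorners ℝ E H}
  {N : Type*} [TopologicalSpace N] [ChartedSpace H N] {g : MetricField I N} {x : N}

theorem isCausal_of_neg {w : TangentSpace I x} (hw : g x w w < 0) : IsCausal I g w := by
  refine ⟨?_, hw.le⟩
  rintro rfl
  exact hw.ne (map_zero _)

theorem sameTimeCone_self {w : TangentSpace I x} (hw : g x w w < 0) : SameTimeCone I g w w :=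
  ⟨w, hw, hw, hw⟩

variable [FiniteDimensional ℝ E]

theorem energyMomentum_nonneg_iff (w₁ w₂ : TangentSpace I x) :
    0 ≤ energyMomentum I g x w₁ w₂ ↔ 0 ≤ 8 * Real.pi * energyMomentum I g x w₁ w₂ :=
  (mul_nonneg_iff_of_pos_left (by positivity)).symm

theorem tensorQ_neg_right (f : N → ℝ) (v w : TangentSpace I x) :
    tensorQ I g f x v (-w) = -tensorQ I g f x v w := by
  simp only [tensorQ, map_neg]
  ring

theorem tensorQ_eq_neg_tensorLstar {v w : TangentSpace I x} (hR : ricci I g x v w = 0)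
    (f : N → ℝ) : tensorQ I g f x v w = -tensorLstar I g f x v w := by
  rw [tensorQ, tensorLstar, hR]
  ring

end Causality

section StaticCausality

variable {s : ℕ} {t₁ t₂ : EReal} {F : Type*} [TopologicalSpace F]
  [ChartedSpace (EuclideanSpace ℝ (Fin s)) F]

theorem fiberProj_sumVector (t : openInterval t₁ t₂) (x : F) (u : TangentSpace 𝓘(ℝ, ℝ) t)
    (v : TangentSpace (𝓡 s) x) : fiberProj t₁ t₂ (t, x) (sumVector t₁ t₂ t x u v) = v := by
  rw [fiberProj, sumVector, mfderiv_snd, mfderiv_prod_left, mfderiv_prod_right]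
  exact zero_add v

theorem staticMetric_apply_of_timeForm_eq_div {gF : MetricField (𝓡 s) F} {f : F → ℝ}
    {p : openInterval t₁ t₂ × F} (hf₀ : f p.2 ≠ 0) {b₁ b₂ : ℝ}
    {w₁ w₂ : TangentSpace (staticModel s) p} (h₁ : timeForm t₁ t₂ p w₁ = b₁ / f p.2)
    (h₂ : timeForm t₁ t₂ p w₂ = b₂ / f p.2) :
    staticMetric t₁ t₂ gF f p w₁ w₂ =
      gF p.2 (fiberProj t₁ t₂ p w₁) (fiberProj t₁ t₂ p w₂) - b₁ * b₂ := by
  rw [staticMetric_apply, h₁, h₂]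
  field_simp

variable [IsManifold (𝓡 s) 1 F]

theorem exists_timeForm_fiberProj_eq (p : openInterval t₁ t₂ × F) (b : ℝ)
    (v : TangentSpace (𝓡 s) p.2) : ∃ w : TangentSpace (staticModel s) p,
      timeForm t₁ t₂ p w = b ∧ fiberProj t₁ t₂ p w = v := by
  obtain ⟨w, hw⟩ := surjective_chartDeriv (I := staticModel s) p (b, chartDeriv (𝓡 s) p.2 v)
  rw [chartDeriv_static, Prod.mk.injEq] at hw
  exact ⟨w, hw.1, (isInvertible_mfderiv_extChartAt (mem_extChartAt_source _)).injective hw.2⟩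

variable {n : ℕ∞ω} (gF : Bundle.ContMDiffRiemannianMetric (𝓡 s) n (EuclideanSpace ℝ (Fin s))
    (fun x : F => TangentSpace (𝓡 s) x)) {f : F → ℝ}

theorem staticMetric_nonpos_of_sameTimeCone {p : openInterval t₁ t₂ × F}
    {w₁ w₂ : TangentSpace (staticModel s) p}
    (h₁ : IsCausal (staticModel s) (staticMetric t₁ t₂ gF.inner f) w₁)
    (h₂ : IsCausal (staticModel s) (staticMetric t₁ t₂ gF.inner f) w₂)
    (hcone : SameTimeCone (staticModel s) (staticMetric t₁ t₂ gF.inner f) w₁ w₂) :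
    staticMetric t₁ t₂ gF.inner f p w₁ w₂ ≤ 0 := by
  obtain ⟨z, hz, hz₁, hz₂⟩ := hcone
  have happly (v w : TangentSpace (staticModel s) p) : staticMetric t₁ t₂ gF.inner f p v w =
      ContinuousLinearMap.toBilinForm (gF.inner p.2) (fiberProj t₁ t₂ p v) (fiberProj t₁ t₂ p w) -
        (f p.2 * timeForm t₁ t₂ p v) * (f p.2 * timeForm t₁ t₂ p w) := by
    rw [staticMetric_apply, sq, mul_mul_mul_comm]
    rfl
  rw [happly, sub_nonpos]
  rw [happly, sub_neg, ← sq] at hz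
  rw [happly, sub_neg] at hz₁ hz₂
  have hw₁ := h₁.2
  have hw₂ := h₂.2
  rw [happly, sub_nonpos, ← sq] at hw₁ hw₂
  exact apply_le_mul_of_apply_lt_mul (isSymm_inner gF p.2) (inner_self_nonneg gF p.2) hz.le
    hw₁ hw₂ hz₁ hz₂

theorem exists_timelike_lift {p : openInterval t₁ t₂ × F} (hf₀ : f p.2 ≠ 0)
    (v₁ v₂ : TangentSpace (𝓡 s) p.2) :
    ∃ w₁ w₂ : TangentSpace (staticModel s) p,
      fiberProj t₁ t₂ p w₁ = v₁ ∧ fiberProj t₁ t₂ p w₂ = v₂ ∧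
      staticMetric t₁ t₂ gF.inner f p w₁ w₁ < 0 ∧ staticMetric t₁ t₂ gF.inner f p w₂ w₂ < 0 ∧
      SameTimeCone (staticModel s) (staticMetric t₁ t₂ gF.inner f) w₁ w₂ := by
  have hv₁ := inner_self_nonneg gF p.2 v₁
  have hv₂ := inner_self_nonneg gF p.2 v₂
  obtain ⟨b, hb⟩ : ∃ b, b = 1 + gF.inner p.2 v₁ v₁ + gF.inner p.2 v₂ v₂ := ⟨_, rfl⟩
  obtain ⟨w₁, ht₁, rfl⟩ := exists_timeForm_fiberProj_eq p (b / f p.2) v₁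
  obtain ⟨w₂, ht₂, rfl⟩ := exists_timeForm_fiberProj_eq p (b / f p.2) v₂
  obtain ⟨z, htz, hPz⟩ := exists_timeForm_fiberProj_eq p (1 / f p.2) (0 : TangentSpace (𝓡 s) p.2)
  refine ⟨w₁, w₂, rfl, rfl, ?_, ?_, z, ?_, ?_, ?_⟩
  · rw [staticMetric_apply_of_timeForm_eq_div hf₀ ht₁ ht₁]
    nlinarith
  · rw [staticMetric_apply_of_timeForm_eq_div hf₀ ht₂ ht₂]
    nlinarith
  · rw [staticMetric_apply_of_timeForm_eq_div hf₀ htz htz, hPz, map_zero]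
    norm_num
  · rw [staticMetric_apply_of_timeForm_eq_div hf₀ htz ht₁, hPz, map_zero, zero_apply]
    linarith
  · rw [staticMetric_apply_of_timeForm_eq_div hf₀ htz ht₂, hPz, map_zero, zero_apply]
    linarith

variable [Nonempty (openInterval t₁ t₂)] (hf₀ : ∀ x, f x ≠ 0)
include hf₀

theorem dominantCondition_iff_of_eq_mul_staticMetric {c : F → ℝ}
    (hT : ∀ (p : openInterval t₁ t₂ × F) (w₁ w₂ : TangentSpace (staticModel s) p),
      8 * Real.pi * energyMomentum (staticModel s) (staticMetric t₁ t₂ gF.inner f) p w₁ w₂ =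
        c p.2 * staticMetric t₁ t₂ gF.inner f p w₁ w₂) :
    DominantCondition (staticModel s) (staticMetric t₁ t₂ gF.inner f) ↔ ∀ x, c x ≤ 0 := by
  simp only [DominantCondition, energyMomentum_nonneg_iff, hT]
  constructor
  · intro hD x
    obtain ⟨t⟩ := ‹Nonempty (openInterval t₁ t₂)›
    obtain ⟨w, -, -, -, hw, -⟩ := exists_timelike_lift gF (p := (t, x)) (hf₀ x) 0 0
    exact nonpos_of_mul_nonneg_left
      (hD (t, x) w w (isCausal_of_neg hw) (isCausal_of_neg hw) (sameTimeCone_self hw)) hw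
  · exact fun hc p w₁ w₂ h₁ h₂ hcone => mul_nonneg_of_nonpos_of_nonpos (hc p.2)
      (staticMetric_nonpos_of_sameTimeCone gF h₁ h₂ hcone)

theorem dominantCondition_iff_of_eq_fiberProj
    {B : (x : F) → TangentSpace (𝓡 s) x → TangentSpace (𝓡 s) x → ℝ}
    (hB : ∀ x v w, B x v (-w) = -B x v w)
    (hT : ∀ (p : openInterval t₁ t₂ × F) (w₁ w₂ : TangentSpace (staticModel s) p),
      8 * Real.pi * energyMomentum (staticModel s) (staticMetric t₁ t₂ gF.inner f) p w₁ w₂ =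
        B p.2 (fiberProj t₁ t₂ p w₁) (fiberProj t₁ t₂ p w₂)) :
    DominantCondition (staticModel s) (staticMetric t₁ t₂ gF.inner f) ↔
      ∀ x v w, B x v w = 0 := by
  simp only [DominantCondition, energyMomentum_nonneg_iff, hT]
  constructor
  · intro hD
    have hnonneg (x : F) (v w : TangentSpace (𝓡 s) x) : 0 ≤ B x v w := by
      obtain ⟨t⟩ := ‹Nonempty (openInterval t₁ t₂)›
      obtain ⟨w₁, w₂, rfl, rfl, h₁, h₂, hcone⟩ :=
        exists_timelike_lift gF (p := (t, x)) (hf₀ x) v w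
      exact hD (t, x) w₁ w₂ (isCausal_of_neg h₁) (isCausal_of_neg h₂) hcone
    intro x v w
    have hneg := hnonneg x v (-w)
    rw [hB, neg_nonneg] at hneg
    exact hneg.antisymm (hnonneg x v w)
  · exact fun hzero p w₁ w₂ _ _ _ => (hzero _ _ _).ge

end StaticCausality

end StaticSpacetime

end

open StaticSpacetime in
theorem mainTheorem9_general (s : ℕ) (t₁ t₂ : EReal) (ht : t₁ < t₂)
    (F : Type*) [TopologicalSpace F] [ChartedSpace (EuclideanSpace ℝ (Fin s)) F]
    [IsManifold (𝓡 s) 3 F]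
    (gF : Bundle.ContMDiffRiemannianMetric (𝓡 s) 2 (EuclideanSpace ℝ (Fin s))
      (fun x : F => TangentSpace (𝓡 s) x))
    (f : F → ℝ) (hf : ContMDiff (𝓡 s) 𝓘(ℝ, ℝ) 2 f) (hf₀ : ∀ x, f x ≠ 0) :
    ((∀ x v w, tensorLstar (𝓡 s) gF.inner f x v w = 0) →
      (∀ (p : openInterval t₁ t₂ × F) (w₁ w₂ : TangentSpace (staticModel s) p),
        8 * Real.pi * energyMomentum (staticModel s) (staticMetric t₁ t₂ gF.inner f) p w₁ w₂ =
          -(1 / 2) * scalarCurvature (𝓡 s) gF.inner p.2 *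
            staticMetric t₁ t₂ gF.inner f p w₁ w₂) ∧
      (DominantCondition (staticModel s) (staticMetric t₁ t₂ gF.inner f) ↔
        ∀ x, 0 ≤ scalarCurvature (𝓡 s) gF.inner x)) ∧
    ((∀ x v w, ricci (𝓡 s) gF.inner x v w = 0) →
      (∀ (t : openInterval t₁ t₂) (x : F) (u₁ u₂ : TangentSpace 𝓘(ℝ, ℝ) t)
        (v₁ v₂ : TangentSpace (𝓡 s) x),
        8 * Real.pi * energyMomentum (staticModel s) (staticMetric t₁ t₂ gF.inner f) (t, x)
            (sumVector t₁ t₂ t x u₁ v₁) (sumVector t₁ t₂ t x u₂ v₂) =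
          1 / f x * tensorQ (𝓡 s) gF.inner f x v₁ v₂) ∧
      (DominantCondition (staticModel s) (staticMetric t₁ t₂ gF.inner f) ↔
        ∀ x v w, tensorQ (𝓡 s) gF.inner f x v w = 0) ∧
      ((∀ x v w, tensorQ (𝓡 s) gF.inner f x v w = 0) ↔
        ∀ x v w, tensorLstar (𝓡 s) gF.inner f x v w = 0)) := by
  have := nonempty_openInterval ht
  refine ⟨fun hL => ?_, fun hR => ?_⟩
  · have hT (p : openInterval t₁ t₂ × F) (w₁ w₂ : TangentSpace (staticModel s) p) :=
      energyMomentum_staticMetric gF hf (hf₀ p.2) w₁ w₂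
    simp only [hL, mul_zero, sub_zero] at hT
    refine ⟨hT, (dominantCondition_iff_of_eq_mul_staticMetric gF hf₀
      (c := fun x => -(1 / 2) * scalarCurvature (𝓡 s) gF.inner x) hT).trans
      (forall_congr' fun x => by constructor <;> intro <;> linarith)⟩
  · have hT (p : openInterval t₁ t₂ × F) (w₁ w₂ : TangentSpace (staticModel s) p) :
        8 * Real.pi * energyMomentum (staticModel s) (staticMetric t₁ t₂ gF.inner f) p w₁ w₂ =
          1 / f p.2 * tensorQ (𝓡 s) gF.inner f p.2 (fiberProj t₁ t₂ p w₁)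
            (fiberProj t₁ t₂ p w₂) := by
      rw [energyMomentum_staticMetric gF hf (hf₀ p.2),
        scalarCurvature_eq_zero_of_ricci (hR p.2), tensorQ_eq_neg_tensorLstar (hR _ _ _)]
      ring
    refine ⟨fun t x u₁ u₂ v₁ v₂ => ?_, ?_, ?_⟩
    · rw [hT, fiberProj_sumVector, fiberProj_sumVector]
    · rw [dominantCondition_iff_of_eq_fiberProj gF hf₀
        (B := fun x v w => 1 / f x * tensorQ (𝓡 s) gF.inner f x v w)
        (fun x v w => by rw [tensorQ_neg_right, mul_neg]) hT]
      simp only [mul_eq_zero, one_div_ne_zero (hf₀ _), false_or]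
    · simp only [tensorQ_eq_neg_tensorLstar (hR _ _ _), neg_eq_zero]

open StaticSpacetime in
theorem mainTheorem9 (s : ℕ) (t₁ t₂ : EReal) (ht : t₁ < t₂)
    (F : Type*) [TopologicalSpace F] [ChartedSpace (EuclideanSpace ℝ (Fin s)) F]
    [IsManifold (𝓡 s) ∞ F]
    (gF : Bundle.ContMDiffRiemannianMetric (𝓡 s) ∞ (EuclideanSpace ℝ (Fin s))
      (fun x : F => TangentSpace (𝓡 s) x))
    (f : F → ℝ) (hf : ContMDiff (𝓡 s) 𝓘(ℝ, ℝ) ∞ f) (hf_pos : ∀ x, 0 < f x) :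
    ((∀ x v w, tensorLstar (𝓡 s) gF.inner f x v w = 0) →
      (∀ (p : openInterval t₁ t₂ × F) (w₁ w₂ : TangentSpace (staticModel s) p),
        8 * Real.pi * energyMomentum (staticModel s) (staticMetric t₁ t₂ gF.inner f) p w₁ w₂ =
          -(1 / 2) * scalarCurvature (𝓡 s) gF.inner p.2 *
            staticMetric t₁ t₂ gF.inner f p w₁ w₂) ∧
      (DominantCondition (staticModel s) (staticMetric t₁ t₂ gF.inner f) ↔
        ∀ x, 0 ≤ scalarCurvature (𝓡 s) gF.inner x)) ∧
    ((∀ x v w, ricci (𝓡 s) gF.inner x v w = 0) →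
      (∀ (t : openInterval t₁ t₂) (x : F) (u₁ u₂ : TangentSpace 𝓘(ℝ, ℝ) t)
        (v₁ v₂ : TangentSpace (𝓡 s) x),
        8 * Real.pi * energyMomentum (staticModel s) (staticMetric t₁ t₂ gF.inner f) (t, x)
            (sumVector t₁ t₂ t x u₁ v₁) (sumVector t₁ t₂ t x u₂ v₂) =
          1 / f x * tensorQ (𝓡 s) gF.inner f x v₁ v₂) ∧
      (DominantCondition (staticModel s) (staticMetric t₁ t₂ gF.inner f) ↔
        ∀ x v w, tensorQ (𝓡 s) gF.inner f x v w = 0) ∧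
      ((∀ x v w, tensorQ (𝓡 s) gF.inner f x v w = 0) ↔
        ∀ x v w, tensorLstar (𝓡 s) gF.inner f x v w = 0)) :=
  mainTheorem9_general s t₁ t₂ ht F
    ⟨gF.inner, gF.symm, gF.pos, gF.isVonNBounded, gF.contMDiff.of_le ENat.LEInfty.out⟩ f
    (hf.of_le ENat.LEInfty.out) fun x => (hf_pos x).ne'
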